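/- Convergence of the joint recovery and estimation algorithm. Model. A finite set of agents $\mathcal V$ is the disjoint union of the regular agents $\mathcal V_r$ and the stubborn agents $\mathcal V_s$, and every agent $i$ has a community label $\mathcal C(i)\in\{1,2\}$. Let $n_k$ be the number of agents in community $k$ and $n_r=|\mathcal V_r|$. At each time $t=0,1,2,\dots$ an edge $\{i,j\}$, $i\ne j$, is selected, independently over time, with probability $w_s$ if $\mathcal C(i)=\mathcal C(j)$ and $w_d$ if $\mathcal C(i)\neq\mathcal C(j)$. Every regular endpoint of the selected edge replaces its state by $q\cdot(\text{own state})+(1-q)\cdot(\text{state of the other endpoint})$, with a fixed $q\in[0,1)$, and all other states are unchanged. The initial state $X(0)$ is deterministic; write $x_i=X_i(0)$ for $i\in\mathcal V_s$. Assumptions. (1) Both communities contain regular agents; $w_s,w_d>0$, $w_s\ne w_d$, and $(n_1(n_1-1)+n_2(n_2-1))w_s+2n_1n_2w_d=2$; for every $i\in\mathcal V_r$, $\min_{l\in\mathcal V_s}x_l\le X_i(0)\le\max_{l\in\mathcal V_s}x_l$. (2) Both communities contain stubborn agents, and the averages $\bar x^{s1}$ and $\bar x^{s2}$ of $x_i$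 over the stubborn agents of communities 1 and 2 are different. (3) For every $i\in\mathcal V_s$ a regular agent $j_i$ with $\mathcal C(j_i)=\mathcal C(i)$ is known. Algorithm. Let $a>0$. The initial values $\hat{\mathcal C}(\cdot,0),\hat w_s(0),\hat w_d(0)$ are arbitrary (possibly random) and $S^r(0)=X^r(0)$. For $t\ge1$ put $S^r_i(t)=\frac{t}{t+1}S^r_i(t-1)+\frac1{t+1}X_i(t)$ for $i\in\mathcal V_r$, and $\bar s^r(t)=\frac1{n_r}\sum_{i\in\mathcal V_r}S_i^r(t)$. Recovery step: for $i\in\mathcal V_r$, $\hat{\mathcal C}(i,t)=1$ if $S^r_i(t)>\bar s^r(t)$ and $\hat{\mathcal C}(i,t)=2$ otherwise; for $i\in\mathcal V_s$, $\hat{\mathcal C}(i,t)=\hat{\mathcal C}(j_i,t)$. Estimation step: let $\hat{\mathcal V}_{rk},\hat{\mathcal V}_{sk}$ be the sets of regular and stubborn agents with $\hat{\mathcal C}(i,t)=k$, let $\hat n_k=|\hat{\mathcal V}_{rk}|+|\hat{\mathcal V}_{sk}|$ (all depending on $t$), and put $$h_1(t)=\frac{|\hat{\mathcal V}_{s1}|}{|\hat{\mathcal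 V}_{r1}|}\sum_{i\in\hat{\mathcal V}_{r1}}S^r_i(t)-\sum_{i\in\hat{\mathcal V}_{s1}}x_i,\qquad h_2(t)=\frac{\hat n_2}{|\hat{\mathcal V}_{r1}|}\sum_{i\in\hat{\mathcal V}_{r1}}S^r_i(t)-\sum_{i\in\hat{\mathcal V}_{r2}}S^r_i(t)-\sum_{i\in\hat{\mathcal V}_{s2}}x_i,$$ $$g(t)=h_1(t)-\frac{\hat n_1^2+\hat n_2^2-\hat n_1-\hat n_2}{2\hat n_1\hat n_2}\,h_2(t),$$ $$\hat w_s(t)=\hat w_s(t-1)-\frac at\,\mathrm{sgn}(g(t))\Big(g(t)\hat w_s(t-1)+\frac{h_2(t)}{\hat n_1\hat n_2}\Big),\qquad \hat w_d(t)=\frac{2-\hat w_s(t)(\hat n_1^2+\hat n_2^2-\hat n_1-\hat n_2)}{2\hat n_1\hat n_2}.$$ (At times at which $\hat{\mathcal V}_{r1}$ is empty, so that these formulas divide by zero, $\hat w_s(t)$ and $\hat w_d(t)$ are given arbitrary values.) Theorem. Under Assumptions (1)–(3) the following holds. (i) There are a deterministic permutation $\sigma$ of the labels $\{1,2\}$ and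 a random variable $T$ with values in the positive integers such that, almost surely, $\hat{\mathcal C}(i,t)=\sigma(\mathcal C(i))$ for all $i\in\mathcal V$ and all $t>T$. Here $\sigma$ is the identity if and only if $(w_s-w_d)(\bar x^{s1}-\bar x^{s2})>0$; hence, when the communities are numbered so that this inequality holds, every label is recovered exactly. (ii) Whatever the numbering of the communities, $\lim_{t\to\infty}(\hat w_s(t),\hat w_d(t))=(w_s,w_d)$ almost surely. -/

import Mathlib

open MeasureTheory ProbabilityTheory Filter Topology

noncomputable section

namespace Gossip

/-- The two community labels. -/
inductive Label where
  | one
  | two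
  deriving DecidableEq

/- The regular agents are the elements of `R`, the stubborn agents those of `S`, and the set of all
agents is the disjoint union `R ⊕ S`. The agents are not assumed to be sorted by community. -/
variable {R S : Type*} [Fintype R] [Fintype S] [DecidableEq R] [DecidableEq S]

/-! ### Communities -/

/-- The regular agents with label `k` under the labelling `c`. -/
def regularIn (c : R ⊕ S → Label) (k : Label) : Finset R :=
  Finset.univ.filter fun r => c (Sum.inl r) = k

/-- The stubborn agents with label `k` under the labelling `c`. -/
def stubbornIn (c : R ⊕ S → Label) (k : Label) : Finset S :=
  Finset.univ.filter fun s => c (Sum.inr s) = k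

/-- The number of agents with label `k` under the labelling `c`, as a real number. -/
def size (c : R ⊕ S → Label) (k : Label) : ℝ :=
  ((Finset.univ.filter fun i : R ⊕ S => c i = k).card : ℝ)

/-- The average of the stubborn states `xs` over the stubborn agents with label `k`. -/
def stubbornAvg (c : R ⊕ S → Label) (xs : S → ℝ) (k : Label) : ℝ :=
  (∑ s ∈ stubbornIn c k, xs s) / ((stubbornIn c k).card : ℝ)

/-- The interaction probability matrix with block structure: zero diagonal, `ws` for distinct agents
of the same community, `wd` for agents of different communities. -/
def interactionMatrix (C : R ⊕ S → Label) (ws wd : ℝ) : Matrix (R ⊕ S) (R ⊕ S) ℝ :=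
  fun i j => if i = j then 0 else if C i = C j then ws else wd

/-! ### The gossip model with stubborn agents -/

/-- One update when the edge `e` is selected: every regular endpoint of `e` moves to
`q * (own state) + (1 - q) * (state of the other endpoint)`; all other agents, in particular all
stubborn ones, keep their states. -/
def update (q : ℝ) (x : R ⊕ S → ℝ) (e : Sym2 (R ⊕ S)) : R ⊕ S → ℝ
  | Sum.inl r =>
      if h : Sum.inl r ∈ e then q * x (Sum.inl r) + (1 - q) * x (Sym2.Mem.other h)
      else x (Sum.inl r)
  | Sum.inr s => x (Sum.inr s)

/-- The state vector `X(t)` of all agents, started at `x0`, when the edge `e t` is selected at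
time `t`. -/
def state (q : ℝ) (x0 : R ⊕ S → ℝ) (e : ℕ → Sym2 (R ⊕ S)) : ℕ → R ⊕ S → ℝ
  | 0 => x0
  | t + 1 => update q (state q x0 e t) (e t)

/-- The random edges `e t`, `t = 0, 1, …`, are independent, and at every time the edge `{i, j}`
is selected with probability `W i j`. The finite set of unordered pairs carries the discrete
σ-algebra. -/
structure IsEdgeSelection {Ω : Type*} [MeasurableSpace Ω] (μ : Measure Ω)
    (W : Matrix (R ⊕ S) (R ⊕ S) ℝ) (e : ℕ → Ω → Sym2 (R ⊕ S)) : Prop where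
  measurable : ∀ t z, MeasurableSet {ω | e t ω = z}
  indep : iIndepFun (m := fun _ => ⊤) e μ
  law : ∀ t i j, i ≠ j → μ {ω | e t ω = s(i, j)} = ENNReal.ofReal (W i j)

/-! ### The assumptions -/

/-- Both communities have regular agents; `ws, wd > 0` and `ws ≠ wd`; the interaction probabilities
sum to one over all edges; every regular agent starts between the smallest and the largest stubborn
state. -/
structure CommunityAssumption (C : R ⊕ S → Label) (ws wd : ℝ) (x0 : R ⊕ S → ℝ) : Prop where
  exists_regular : ∀ k, ∃ r : R, C (Sum.inl r) = k
  ws_pos : 0 < ws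
  wd_pos : 0 < wd
  ws_ne_wd : ws ≠ wd
  total : (size C .one * (size C .one - 1) + size C .two * (size C .two - 1)) * ws
      + 2 * size C .one * size C .two * wd = 2
  init_mem : ∀ r : R, x0 (Sum.inl r) ∈
      Set.Icc (⨅ s : S, x0 (Sum.inr s)) (⨆ s : S, x0 (Sum.inr s))

/-- Both communities have stubborn agents, and the averages of the stubborn states in the two
communities differ. -/
structure StubbornAssumption (C : R ⊕ S → Label) (xs : S → ℝ) : Prop where
  exists_stubborn : ∀ k, ∃ s : S, C (Sum.inr s) = k
  avg_ne : stubbornAvg C xs .one ≠ stubbornAvg C xs .two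

/-! ### The algorithm

Its inputs are the observed regular states `x t`, `t = 0, 1, …`, the stubborn states `xs`, the map
`j` that gives for every stubborn agent a regular agent known to be in the same community, and the
step-size parameter `a`. -/

/-- The running time average `S^r(t)` of the regular states. -/
def timeAvg (x : ℕ → R → ℝ) : ℕ → R → ℝ
  | 0 => x 0
  | t + 1 => fun r =>
      ((t : ℝ) + 1) / ((t : ℝ) + 2) * timeAvg x t r + 1 / ((t : ℝ) + 2) * x (t + 1) r

/-- The label of a regular agent computed from the time averages `s`: label one if its time average
exceeds the mean over all regular agents, and label two otherwise. -/
def regularLabel (s : R → ℝ) (r : R) : Label :=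
  if (∑ r', s r') / (Fintype.card R : ℝ) < s r then .one else .two

/-- The recovery step for the time averages `s`: a stubborn agent `i` gets the label of `j i`. -/
def recover (j : S → R) (s : R → ℝ) : R ⊕ S → Label
  | Sum.inl r => regularLabel s r
  | Sum.inr i => regularLabel s (j i)

/-- The label estimates at time `t`; at time zero they are the arbitrary initial labels `c0`. -/
def labelHat (j : S → R) (c0 : R ⊕ S → Label) (x : ℕ → R → ℝ) : ℕ → R ⊕ S → Label
  | 0 => c0
  | t + 1 => recover j (timeAvg x (t + 1))

/-- The quantity `h₁` for the labelling `c`, time averages `s` and stubborn states `xs`. -/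
def h₁ (c : R ⊕ S → Label) (s : R → ℝ) (xs : S → ℝ) : ℝ :=
  ((stubbornIn c .one).card : ℝ) / ((regularIn c .one).card : ℝ) * ∑ r ∈ regularIn c .one, s r
    - ∑ i ∈ stubbornIn c .one, xs i

/-- The quantity `h₂` for the labelling `c`, time averages `s` and stubborn states `xs`. -/
def h₂ (c : R ⊕ S → Label) (s : R → ℝ) (xs : S → ℝ) : ℝ :=
  size c .two / ((regularIn c .one).card : ℝ) * ∑ r ∈ regularIn c .one, s r
    - ∑ r ∈ regularIn c .two, s r - ∑ i ∈ stubbornIn c .two, xs i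

/-- The quantity `g` for the labelling `c`, time averages `s` and stubborn states `xs`. -/
def g (c : R ⊕ S → Label) (s : R → ℝ) (xs : S → ℝ) : ℝ :=
  h₁ c s xs - (size c .one ^ 2 + size c .two ^ 2 - size c .one - size c .two)
    / (2 * size c .one * size c .two) * h₂ c s xs

/-- The update of the estimate `w` of `ws` at time `t`. -/
def wsStep (a : ℝ) (t : ℕ) (c : R ⊕ S → Label) (s : R → ℝ) (xs : S → ℝ) (w : ℝ) : ℝ :=
  w - a / (t : ℝ) * Real.sign (g c s xs)
    * (g c s xs * w + h₂ c s xs / (size c .one * size c .two))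

/-- The estimate of `wd` that corresponds to the estimate `w` of `ws`. -/
def wdOf (c : R ⊕ S → Label) (w : ℝ) : ℝ :=
  (2 - w * (size c .one ^ 2 + size c .two ^ 2 - size c .one - size c .two))
    / (2 * size c .one * size c .two)

/-- The estimate of `ws` at time `t`, with initial value `w0`. If the recovery step has given no
regular agent the label one, the formula of the estimation step divides by zero; the estimate is
then an arbitrary number `alt t`. -/
def wsHat (j : S → R) (xs : S → ℝ) (a w0 : ℝ) (alt : ℕ → ℝ) (x : ℕ → R → ℝ) : ℕ → ℝ
  | 0 => w0
  | t + 1 =>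
      if (regularIn (recover j (timeAvg x (t + 1))) .one).Nonempty then
        wsStep a (t + 1) (recover j (timeAvg x (t + 1))) (timeAvg x (t + 1)) xs
          (wsHat j xs a w0 alt x t)
      else alt (t + 1)

/-- The estimate of `wd` at time `t`, with initial value `w0'`, where `w t` is the estimate of `ws`;
an arbitrary number `alt' t` if the formula divides by zero. -/
def wdHat (j : S → R) (w0' : ℝ) (alt' : ℕ → ℝ) (x : ℕ → R → ℝ) (w : ℕ → ℝ) : ℕ → ℝ
  | 0 => w0'
  | t + 1 =>
      if (regularIn (recover j (timeAvg x (t + 1))) .one).Nonempty then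
        wdOf (recover j (timeAvg x (t + 1))) (w (t + 1))
      else alt' (t + 1)

end Gossip

end

open Gossip

/-! Given the past, the expected increment of a regular state is `1 - q` times the Laplacian of the
interaction matrix applied to the current state. Summed up to time `n` and divided by `n`, the
increments telescope to a bounded quantity over `n`, and their deviations from the conditional means
vanish by a strong law (`strong_law_predictable`). Hence the time averages are almost surely
asymptotically harmonic at the regular agents (`tendsto_laplacian_avg`); no ergodic theory of the
Markov chain is needed. Each regular agent has positive weight to the stubborn ones, so a maximum
principle (`mul_abs_le_sum_abs_laplacian`) makes the averages converge to the harmonic extension of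
the stubborn states. By the block structure this extension takes one value `m k` on the regular
agents of each community, given by a two-by-two linear system.

Solving that system shows that `m .one - m .two` has the sign of `(ws - wd) * (x̄₁ - x̄₂)`. If this
is positive, the mean over the regular agents separates the two limits, and recovery is eventually
exact. The equilibrium equation of community one reads `ws * h₁ + wd * h₂ = 0`; eliminating `wd` by
the normalisation turns it into `g * ws + h₂ / (n₁ * n₂) = 0`, with `g ≠ 0`. The factor `sgn g`
makes the estimation step a contraction towards this root, and the divergence of the harmonic series
drives the error to zero (`tendsto_of_affine_recursion`).

If the product is negative, swapping the labels makes it positive. The algorithm never sees the true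
labelling, so the same argument applies to the swapped one. -/

/-! ### Strong law for bounded martingale differences -/

/-- If `|f|` grows at most linearly with slope `K` and `f (k ^ 2) / k ^ 2 → 0`, then
`f n / n → 0`. -/
theorem tendsto_div_of_tendsto_sq {f : ℕ → ℝ} {K : ℝ} (hf : ∀ n, |f (n + 1) - f n| ≤ K)
    (hsq : Tendsto (fun k : ℕ => f ((k + 1) ^ 2) / ((k : ℝ) + 1) ^ 2) atTop (𝓝 0)) :
    Tendsto (fun n : ℕ => f n / n) atTop (𝓝 0) := by
  have hK : 0 ≤ K := (abs_nonneg _).trans (hf 0)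
  have hlip : ∀ m d, |f (m + d)| ≤ |f m| + d * K := by
    intro m d
    induction d with
    | zero => simp
    | succ d ih =>
      have h1 := hf (m + d)
      have h2 := abs_add_le (f (m + d + 1) - f (m + d)) (f (m + d))
      rw [sub_add_cancel] at h2
      push_cast
      rw [← add_assoc]
      linarith
  -- The hypothesis is indexed so that `k` stands for the square `(k + 1) ^ 2`; the largest square
  -- below `n` therefore has index `Nat.sqrt n - 1`.
  have hsqrt : Tendsto (fun n : ℕ => Nat.sqrt n - 1) atTop atTop := by
    refine tendsto_atTop.2 fun b => ?_
    filter_upwards [eventually_ge_atTop ((b + 1) ^ 2)] with n hn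
    have : b + 1 ≤ Nat.sqrt n := Nat.le_sqrt'.2 hn
    omega
  have hlim : Tendsto (fun n : ℕ =>
      |f ((Nat.sqrt n - 1 + 1) ^ 2) / (((Nat.sqrt n - 1 : ℕ) : ℝ) + 1) ^ 2|
      + 2 * K * (1 / (((Nat.sqrt n - 1 : ℕ) : ℝ) + 1))) atTop (𝓝 0) := by
    have h1 := (hsq.comp hsqrt).abs
    have h2 := ((tendsto_one_div_add_atTop_nhds_zero_nat (𝕜 := ℝ)).comp hsqrt).const_mul (2 * K)
    simpa using h1.add h2
  refine squeeze_zero_norm' ?_ hlim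
  filter_upwards [eventually_ge_atTop 1] with n hn
  have hs1 : 1 ≤ Nat.sqrt n := Nat.le_sqrt'.2 (by simpa using hn)
  obtain ⟨k, hk⟩ : ∃ k, Nat.sqrt n = k + 1 := ⟨Nat.sqrt n - 1, by omega⟩
  have hle : (k + 1) ^ 2 ≤ n := hk ▸ Nat.sqrt_le' n
  -- Within a gap between squares `f` moves by at most `2 * (k + 1) * K`, negligible against `(k +
  -- 1) ^ 2`.
  have hlt : n ≤ (k + 1) ^ 2 + 2 * (k + 1) := by
    have := Nat.sqrt_le_add n
    rw [hk] at this
    nlinarith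
  obtain ⟨d, rfl⟩ := Nat.exists_eq_add_of_le hle
  have hd : d ≤ 2 * (k + 1) := by omega
  rw [hk, Nat.add_sub_cancel, Real.norm_eq_abs, abs_div, abs_div]
  have hk0 : (0 : ℝ) < (k : ℝ) + 1 := by positivity
  have hden : |(((k + 1) ^ 2 + d : ℕ) : ℝ)| = ((k : ℝ) + 1) ^ 2 + d := by
    rw [Nat.abs_cast]; push_cast; ring
  have hd' : (d : ℝ) ≤ 2 * ((k : ℝ) + 1) := by exact_mod_cast hd
  rw [hden, abs_of_pos (pow_pos hk0 2)]
  calc |f ((k + 1) ^ 2 + d)| / (((k : ℝ) + 1) ^ 2 + d)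
      ≤ (|f ((k + 1) ^ 2)| + 2 * ((k : ℝ) + 1) * K) / ((k : ℝ) + 1) ^ 2 := by
        refine div_le_div₀ (by positivity) ((hlip _ _).trans ?_) (by positivity) (by simp)
        gcongr
    _ = _ := by field_simp

section StrongLaw

variable {Ω E : Type*} [MeasurableSpace Ω] {μ : Measure Ω}

/-- `F` depends only on the first `n` terms of a sequence. -/
def DependsOnFirst (n : ℕ) (F : (ℕ → E) → ℝ) : Prop :=
  ∀ x y : ℕ → E, (∀ u < n, x u = y u) → F x = F y

/-- Padding a finite word with an arbitrary letter does not affect `F`. The factorisation through a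
finite product gives measurability for free and lets independence of finite blocks apply. -/
theorem DependsOnFirst.exists_restrict [Nonempty E] {n : ℕ} {F : (ℕ → E) → ℝ}
    (hF : DependsOnFirst n F) :
    ∃ G : (Finset.range n → E) → ℝ, ∀ x, F x = G fun u => x u := by
  classical
  refine ⟨fun v => F fun k => if h : k ∈ Finset.range n then v ⟨k, h⟩ else Classical.arbitrary E,
    fun x => hF _ _ fun u hu => ?_⟩
  simp [hu]

theorem DependsOnFirst.measurable [Finite E] [MeasurableSpace E]
    [DiscreteMeasurableSpace E] [Nonempty E] {n : ℕ} {F : (ℕ → E) → ℝ}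
    (hF : DependsOnFirst n F) {e : ℕ → Ω → E} (he : ∀ n, Measurable (e n)) :
    Measurable fun ω => F fun u => e u ω := by
  obtain ⟨G, hG⟩ := hF.exists_restrict
  simp only [hG]
  exact (measurable_of_finite G).comp (measurable_pi_lambda _ fun u => he u)

/-- A function of the first `n` terms of an independent sequence is uncorrelated with a centred
function of the `n`-th term. -/
theorem DependsOnFirst.integral_mul_eq_zero [Finite E] [MeasurableSpace E]
    [DiscreteMeasurableSpace E] [Nonempty E] {n : ℕ} {F : (ℕ → E) → ℝ}
    (hF : DependsOnFirst n F) {e : ℕ → Ω → E} (he : ∀ n, Measurable (e n)) (hind : iIndepFun e μ)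
    (φ : E → ℝ) (hφ : ∫ ω, φ (e n ω) ∂μ = 0) :
    ∫ ω, F (fun u => e u ω) * φ (e n ω) ∂μ = 0 := by
  obtain ⟨G, hG⟩ := hF.exists_restrict
  have h1 : IndepFun (fun ω (u : Finset.range n) => e u ω)
      (fun ω (u : ({n} : Finset ℕ)) => e u ω) μ :=
    hind.indepFun_finset _ _ (by simp) he
  have h2 := h1.comp (measurable_of_finite G)
    (measurable_of_finite fun v : ({n} : Finset ℕ) → E => φ (v ⟨n, by simp⟩))
  simp only [hG]
  have h3 := h2.integral_fun_mul_eq_mul_integral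
    ((measurable_of_finite G).comp
      (measurable_pi_lambda _ fun u => he u)).aestronglyMeasurable
    ((measurable_of_finite φ).comp (he n)).aestronglyMeasurable
  simp only [Function.comp_def] at h3
  rw [h3, hφ, mul_zero]

/-- Strong law of large numbers for bounded martingale differences driven by an independent
sequence in a finite type. -/
theorem strong_law_predictable [IsProbabilityMeasure μ] [Fintype E] [MeasurableSpace E]
    [DiscreteMeasurableSpace E] [Nonempty E] {e : ℕ → Ω → E} (he : ∀ n, Measurable (e n))
    (hind : iIndepFun e μ) {p : ℕ → E → ℝ}
    (hp : ∀ n z, μ.real (e n ⁻¹' {z}) = p n z)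
    (D : ℕ → E → (ℕ → E) → ℝ) (hD : ∀ n z, DependsOnFirst n (D n z)) {K : ℝ}
    (hK : ∀ n x, |D n (x n) x - ∑ z, p n z * D n z x| ≤ K) :
    ∀ᵐ ω ∂μ, Tendsto (fun n : ℕ => (∑ u ∈ Finset.range n,
      (D u (e u ω) (fun k => e k ω) - ∑ z, p u z * D u z (fun k => e k ω))) / n) atTop (𝓝 0) := by
  classical
  set M : ℕ → (ℕ → E) → ℝ := fun n x => D n (x n) x - ∑ z, p n z * D n z x with hM
  set Sm : ℕ → (ℕ → E) → ℝ := fun n x => ∑ u ∈ Finset.range n, M u x with hSm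
  have hMdep : ∀ n, DependsOnFirst (n + 1) (M n) := by
    intro n x y hxy
    have hlt : ∀ u < n, x u = y u := fun u hu => hxy u (by omega)
    simp only [hM, hxy n (Nat.lt_succ_self n)]
    congr 1
    · exact hD n _ x y hlt
    · exact Finset.sum_congr rfl fun z _ => by rw [hD n z x y hlt]
  have hSdep : ∀ n, DependsOnFirst n (Sm n) := by
    intro n x y hxy
    refine Finset.sum_congr rfl fun u hu => hMdep u x y fun k hk => hxy k ?_
    have := Finset.mem_range.1 hu
    omega
  have hK0 : 0 ≤ K := (abs_nonneg _).trans (hK 0 fun _ => Classical.arbitrary E)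
  have hSbd : ∀ n x, |Sm n x| ≤ n * K := by
    intro n x
    refine (Finset.abs_sum_le_sum_abs _ _).trans ?_
    simpa using Finset.sum_le_sum fun u (_ : u ∈ Finset.range n) => hK u x
  have hint : ∀ {n : ℕ} {F : (ℕ → E) → ℝ} {B : ℝ}, DependsOnFirst n F → (∀ x, |F x| ≤ B) →
      Integrable (fun ω => F fun u => e u ω) μ := fun hF hB =>
    Integrable.of_bound (hF.measurable he).aestronglyMeasurable _
      (ae_of_all _ fun ω => hB _)
  have horth : ∀ n, ∫ ω, Sm n (fun u => e u ω) * M n (fun u => e u ω) ∂μ = 0 := by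
    intro n
    -- Splitting by the value `z` of the new term writes the product as predictable factors times
    -- centred indicators, each of mean zero by independence.
    have key : ∀ x : ℕ → E, Sm n x * M n x
        = ∑ z, (Sm n x * D n z x) * ((if x n = z then 1 else 0) - p n z) := by
      intro x
      simp only [hM, mul_sub, Finset.sum_sub_distrib, mul_ite, mul_one, mul_zero,
        Finset.sum_ite_eq, Finset.mem_univ, if_true, Finset.mul_sum]
      congr 1
      exact Finset.sum_congr rfl fun z _ => by ring
    have hdep : ∀ z, DependsOnFirst n fun x => Sm n x * D n z x := fun z x y hxy => by
      simp only [hSdep n x y hxy, hD n z x y hxy]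
    have hφ : ∀ z, ∫ ω, ((if e n ω = z then (1 : ℝ) else 0) - p n z) ∂μ = 0 := by
      intro z
      have h1 : (fun ω => if e n ω = z then (1 : ℝ) else 0)
          = (e n ⁻¹' {z}).indicator 1 := by
        ext ω; simp [Set.indicator_apply]
      have hms : MeasurableSet (e n ⁻¹' {z}) := he n (measurableSet_singleton z)
      rw [integral_sub (h1 ▸ (integrable_const 1).indicator hms) (integrable_const _), h1,
        integral_indicator_one hms, hp]
      simp
    simp only [key]
    rw [integral_finsetSum _ fun z _ => ?_]
    · exact Finset.sum_eq_zero fun z _ => (hdep z).integral_mul_eq_zero he hind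
        (fun y => (if y = z then 1 else 0) - p n z) (hφ z)
    · have hdep' : DependsOnFirst (n + 1) fun x : ℕ → E =>
          (Sm n x * D n z x) * ((if x n = z then 1 else 0) - p n z) := by
        intro x y hxy
        have h1 : Sm n x * D n z x = Sm n y * D n z y := hdep z x y fun u hu => hxy u (by omega)
        simp only [h1, hxy n (Nat.lt_succ_self n)]
      -- No explicit bound is needed: the function factors through a finite set.
      obtain ⟨G, hG⟩ := hdep'.exists_restrict
      obtain ⟨B, hB⟩ := (Set.finite_range G).isBounded.exists_norm_le
      refine hint hdep' (B := B) fun x => ?_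
      simp only [hG]
      exact hB _ ⟨_, rfl⟩
  have hvar : ∀ n, ∫ ω, Sm n (fun u => e u ω) ^ 2 ∂μ ≤ n * K ^ 2 := by
    intro n
    induction n with
    | zero => simp [hSm]
    | succ n ih =>
      have hexp : ∀ x, Sm (n + 1) x ^ 2 = Sm n x ^ 2 + 2 * (Sm n x * M n x) + M n x ^ 2 := by
        intro x
        simp only [hSm, Finset.sum_range_succ]
        ring
      have i1 : Integrable (fun ω => Sm n (fun u => e u ω) ^ 2) μ :=
        hint (n := n) (F := fun x => Sm n x ^ 2) (B := (n * K) ^ 2)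
          (fun x y h => by simp only [hSdep n x y h])
          (fun x => by rw [abs_pow]; exact pow_le_pow_left₀ (abs_nonneg _) (hSbd n x) 2)
      have i2 : Integrable (fun ω => Sm n (fun u => e u ω) * M n (fun u => e u ω)) μ :=
        hint (n := n + 1) (F := fun x => Sm n x * M n x) (B := (n * K) * K)
          (fun x y h => by
            simp only [hMdep n x y h, hSdep n x y fun u hu => h u (by omega)])
          (fun x => by
            rw [abs_mul]
            exact mul_le_mul (hSbd n x) (hK n x) (abs_nonneg _) (by positivity))
      have i3 : Integrable (fun ω => M n (fun u => e u ω) ^ 2) μ :=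
        hint (n := n + 1) (F := fun x => M n x ^ 2) (B := K ^ 2)
          (fun x y h => by simp only [hMdep n x y h])
          (fun x => by rw [abs_pow]; exact pow_le_pow_left₀ (abs_nonneg _) (hK n x) 2)
      simp only [hexp]
      have hsplit := integral_add (i1.add (i2.const_mul 2)) i3
      simp only [Pi.add_apply] at hsplit
      rw [hsplit, integral_add i1 (i2.const_mul 2), integral_const_mul, horth]
      have h3 : ∫ ω, M n (fun u => e u ω) ^ 2 ∂μ ≤ K ^ 2 := by
        have := integral_mono i3 (integrable_const (K ^ 2)) fun ω => by
          simpa using pow_le_pow_left₀ (abs_nonneg _) (hK n fun u => e u ω) 2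
        simpa using this
      push_cast
      linarith
  have hsum : ∀ᵐ ω ∂μ, Tendsto (fun k : ℕ => Sm ((k + 1) ^ 2) (fun u => e u ω)
      / ((k : ℝ) + 1) ^ 2) atTop (𝓝 0) := by
    -- Along squares the second moments of the normalised sums are at most `K ^ 2 / (k + 1) ^ 2`.
    -- Their sum is finite, so almost surely `∑ Y k` is finite and its terms tend to zero.
    set Y : ℕ → Ω → ℝ := fun k ω => (Sm ((k + 1) ^ 2) (fun u => e u ω) / ((k : ℝ) + 1) ^ 2) ^ 2
    have hYm : ∀ k, Measurable (Y k) := fun k =>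
      (((hSdep _).measurable he).div_const _).pow_const 2
    have hYint : ∀ k, ∫⁻ ω, ENNReal.ofReal (Y k ω) ∂μ
        ≤ ENNReal.ofReal (K ^ 2 * (1 / ((k : ℝ) + 1) ^ 2)) := by
      intro k
      have hI : Integrable (Y k) μ := by
        refine Integrable.of_bound (hYm k).aestronglyMeasurable (K ^ 2) (ae_of_all _ fun ω => ?_)
        rw [Real.norm_eq_abs, abs_pow, abs_div,
          abs_of_pos (by positivity : (0 : ℝ) < ((k : ℝ) + 1) ^ 2)]
        refine pow_le_pow_left₀ (by positivity) ?_ 2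
        rw [div_le_iff₀ (by positivity), mul_comm]
        have h1 := hSbd ((k + 1) ^ 2) fun u => e u ω
        push_cast at h1
        exact h1
      rw [← ofReal_integral_eq_lintegral_ofReal hI (ae_of_all _ fun ω => sq_nonneg _)]
      refine ENNReal.ofReal_le_ofReal ?_
      have h1 := hvar ((k + 1) ^ 2)
      simp only [Y, div_pow]
      rw [integral_div, div_le_iff₀ (by positivity)]
      push_cast at h1
      refine h1.trans (le_of_eq ?_)
      field_simp
    have hfin : ∑' k, ∫⁻ ω, ENNReal.ofReal (Y k ω) ∂μ ≠ ⊤ := by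
      refine ne_top_of_le_ne_top ?_ (ENNReal.tsum_le_tsum hYint)
      have hs : Summable fun k : ℕ => K ^ 2 * (1 / ((k : ℝ) + 1) ^ 2) := by
        refine Summable.mul_left _ ?_
        have := (summable_nat_add_iff 1).2 (Real.summable_one_div_nat_pow.2 one_lt_two)
        simpa using this
      exact hs.tsum_ofReal_ne_top
    rw [← lintegral_tsum fun k => (hYm k).ennreal_ofReal.aemeasurable] at hfin
    filter_upwards [ae_lt_top (Measurable.tsum fun k => (hYm k).ennreal_ofReal) hfin]
      with ω hω
    have h1 := ENNReal.tendsto_atTop_zero_of_tsum_ne_top hω.ne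
    have h2 := (ENNReal.tendsto_toReal ENNReal.zero_ne_top).comp h1
    have h3 : Tendsto (fun k => Y k ω) atTop (𝓝 0) := by
      refine (h2.congr fun k => ?_)
      simp only [Function.comp]
      exact ENNReal.toReal_ofReal (sq_nonneg _)
    have h4 := h3.sqrt
    simp only [Y, Real.sqrt_sq_eq_abs, Real.sqrt_zero] at h4
    exact (tendsto_zero_iff_abs_tendsto_zero _).2 h4
  filter_upwards [hsum] with ω hω
  refine tendsto_div_of_tendsto_sq (f := fun n => Sm n fun u => e u ω) (K := K) (fun n => ?_) hω
  simp only [hSm, Finset.sum_range_succ, add_sub_cancel_left]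
  exact hK n fun u => e u ω

end StrongLaw

/-! ### Gossip dynamics: drift and asymptotic harmonicity -/

namespace Gossip

section Model

theorem timeAvg_eq {R : Type*} (x : ℕ → R → ℝ) (t : ℕ) (r : R) :
    timeAvg x t r = (∑ u ∈ Finset.range (t + 1), x u r) / ((t + 1 : ℕ) : ℝ) := by
  induction t with
  | zero => simp [timeAvg]
  | succ t ih =>
    simp only [timeAvg]
    rw [ih, Finset.sum_range_succ _ (t + 1)]
    push_cast
    have h1 : (t : ℝ) + 1 ≠ 0 := by positivity
    have h2 : (t : ℝ) + 2 ≠ 0 := by positivity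
    have h3 : (t : ℝ) + 1 + 1 ≠ 0 := by positivity
    field_simp
    ring
variable {R S : Type*} [DecidableEq R] [DecidableEq S]

theorem update_mk_inl (q : ℝ) (x : R ⊕ S → ℝ) (r : R) (i : R ⊕ S) :
    update q x s(Sum.inl r, i) (Sum.inl r) = q * x (Sum.inl r) + (1 - q) * x i := by
  have h : (Sum.inl r : R ⊕ S) ∈ s(Sum.inl r, i) := Sym2.mem_mk_left _ _
  have ho : Sym2.Mem.other h = i := Sym2.congr_right.1 (Sym2.other_spec h)
  rw [update, dif_pos h, ho]

theorem update_inl_of_notMem (q : ℝ) (x : R ⊕ S → ℝ) {r : R} {z : Sym2 (R ⊕ S)}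
    (h : Sum.inl r ∉ z) : update q x z (Sum.inl r) = x (Sum.inl r) := by
  rw [update, dif_neg h]

/-- The expected increment of a regular state is the Laplacian of the interaction matrix. -/
theorem sum_mul_update_sub [Fintype R] [Fintype S] (q : ℝ) (x : R ⊕ S → ℝ) (r : R)
    {W : Matrix (R ⊕ S) (R ⊕ S) ℝ} {p : Sym2 (R ⊕ S) → ℝ} (hp : ∀ i j, i ≠ j → p s(i, j) = W i j) :
    ∑ z, p z * (update q x z (Sum.inl r) - x (Sum.inl r))
      = (1 - q) * ∑ i, W (Sum.inl r) i * (x i - x (Sum.inl r)) := by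
  symm
  rw [Finset.mul_sum]
  -- Only edges through `r` move its state, and these are parametrised by their other endpoint.
  refine Finset.sum_of_injOn (fun i => s(Sum.inl r, i)) (fun i _ k _ h => Sym2.congr_right.1 h)
    (fun i _ => Finset.mem_coe.2 (Finset.mem_univ _)) (fun z _ hz => ?_) (fun i _ => ?_)
  · rw [update_inl_of_notMem, sub_self, mul_zero]
    rintro ⟨i, rfl⟩
    exact hz ⟨i, by simp, rfl⟩
  · simp only [update_mk_inl]
    -- The loop at `r` moves nothing, so `p` and `W` need to agree only off the diagonal.
    by_cases h : Sum.inl r = i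
    · subst h; ring
    · rw [hp _ _ h]; ring

/-- The edge `e t` acts only in passing to time `t + 1`. This predictability is what the strong law
requires of the increments. -/
theorem dependsOnFirst_state (q : ℝ) (x0 : R ⊕ S → ℝ) (t : ℕ) (i : R ⊕ S) :
    DependsOnFirst t fun e => state q x0 e t i := by
  suffices h : ∀ x y : ℕ → Sym2 (R ⊕ S), (∀ u < t, x u = y u) → state q x0 x t = state q x0 y t from
    fun x y hxy => congrFun (h x y hxy) i
  induction t with
  | zero => intro x y _; rfl
  | succ t ih =>
    intro x y hxy
    rw [state, state, ih x y fun u hu => hxy u (by omega), hxy t (Nat.lt_succ_self t)]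

theorem abs_update_le {q B : ℝ} (hq : q ∈ Set.Ico (0 : ℝ) 1) {x : R ⊕ S → ℝ}
    (hx : ∀ i, |x i| ≤ B) (z : Sym2 (R ⊕ S)) (i : R ⊕ S) : |update q x z i| ≤ B := by
  cases i with
  | inr s => exact hx _
  | inl r =>
    by_cases h : Sum.inl r ∈ z
    · obtain ⟨i, rfl⟩ := h
      rw [update_mk_inl]
      obtain ⟨h1, h2⟩ := abs_le.1 (hx (Sum.inl r))
      obtain ⟨h3, h4⟩ := abs_le.1 (hx i)
      have hq1 : 0 ≤ 1 - q := by linarith [hq.2]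
      have := mul_le_mul_of_nonneg_left h1 hq.1
      have := mul_le_mul_of_nonneg_left h2 hq.1
      have := mul_le_mul_of_nonneg_left h3 hq1
      have := mul_le_mul_of_nonneg_left h4 hq1
      exact abs_le.2 ⟨by linarith, by linarith⟩
    · rw [update_inl_of_notMem _ _ h]
      exact hx _

theorem abs_state_le {q B : ℝ} (hq : q ∈ Set.Ico (0 : ℝ) 1) {x0 : R ⊕ S → ℝ}
    (hx : ∀ i, |x0 i| ≤ B) (e : ℕ → Sym2 (R ⊕ S)) (t : ℕ) (i : R ⊕ S) :
    |state q x0 e t i| ≤ B := by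
  induction t generalizing i with
  | zero => exact hx i
  | succ t ih => exact abs_update_le hq ih _ _

theorem state_inr (q : ℝ) (x0 : R ⊕ S → ℝ) (e : ℕ → Sym2 (R ⊕ S)) (t : ℕ) (s : S) :
    state q x0 e t (Sum.inr s) = x0 (Sum.inr s) := by
  induction t with
  | zero => rfl
  | succ t ih => rw [state, update, ih]

variable {Ω : Type*} [MeasurableSpace Ω] {μ : Measure Ω}

theorem IsEdgeSelection.measurable_top {R S : Type*} [Fintype R] [Fintype S]
    {W : Matrix (R ⊕ S) (R ⊕ S) ℝ}
    {e : ℕ → Ω → Sym2 (R ⊕ S)} (he : IsEdgeSelection μ W e) (t : ℕ) :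
    Measurable[_, ⊤] (e t) := by
  intro A _
  have : e t ⁻¹' A = ⋃ z ∈ A, {ω | e t ω = z} := by ext ω; simp
  rw [this]
  exact MeasurableSet.biUnion A.to_countable fun z _ => he.measurable t z

/-- Almost surely, the time averages of the states are asymptotically harmonic at the regular
agents. -/
theorem IsEdgeSelection.tendsto_laplacian_avg [Fintype R] [Fintype S] [IsProbabilityMeasure μ]
    {q : ℝ} (hq : q ∈ Set.Ico (0 : ℝ) 1) (x0 : R ⊕ S → ℝ) {W : Matrix (R ⊕ S) (R ⊕ S) ℝ}
    (hW : ∀ i j, 0 ≤ W i j) {e : ℕ → Ω → Sym2 (R ⊕ S)} (he : IsEdgeSelection μ W e) (r : R) :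
    ∀ᵐ ω ∂μ, Tendsto (fun n : ℕ => ∑ i, W (Sum.inl r) i *
      ((∑ u ∈ Finset.range n, state q x0 (fun k => e k ω) u i) / n
        - (∑ u ∈ Finset.range n, state q x0 (fun k => e k ω) u (Sum.inl r)) / n))
      atTop (𝓝 0) := by
  let _ : MeasurableSpace (Sym2 (R ⊕ S)) := ⊤
  have : DiscreteMeasurableSpace (Sym2 (R ⊕ S)) := ⟨fun _ => trivial⟩
  have : Nonempty (Sym2 (R ⊕ S)) := ⟨s(Sum.inl r, Sum.inl r)⟩
  obtain ⟨B, hB⟩ := (Set.finite_range x0).isBounded.exists_norm_le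
  have hB : ∀ i, |x0 i| ≤ B := fun i => hB _ ⟨i, rfl⟩
  have hB0 : 0 ≤ B := (abs_nonneg _).trans (hB (Sum.inl r))
  have hp : ∀ n i j, i ≠ j → μ.real (e n ⁻¹' {s(i, j)}) = W i j := fun n i j hij => by
    rw [measureReal_def, show e n ⁻¹' {s(i, j)} = {ω | e n ω = s(i, j)} from rfl,
      he.law n i j hij, ENNReal.toReal_ofReal (hW i j)]
  have hdrift : ∀ n x, ∑ z, μ.real (e n ⁻¹' {z}) *
      (update q (state q x0 x n) z (Sum.inl r) - state q x0 x n (Sum.inl r))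
      = (1 - q) * ∑ i, W (Sum.inl r) i * (state q x0 x n i - state q x0 x n (Sum.inl r)) :=
    fun n x => sum_mul_update_sub q _ r (p := fun z => μ.real (e n ⁻¹' {z})) (hp n)
  have hdiff : ∀ {y y' : ℝ}, |y| ≤ B → |y'| ≤ B → |y - y'| ≤ 2 * B := fun h h' =>
    (abs_sub _ _).trans (by linarith)
  have hlaw := strong_law_predictable (μ := μ) he.measurable_top he.indep (fun n z => rfl)
    (fun n z x => update q (state q x0 x n) z (Sum.inl r) - state q x0 x n (Sum.inl r))
    (fun n z x y hxy => by
      have h : state q x0 x n = state q x0 y n :=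
        funext fun i => dependsOnFirst_state q x0 n i x y hxy
      simp only [h])
    -- States stay in `[-B, B]`, so an increment is at most `2 * B`; the sum bounds the drift, whose
    -- factor `1 - q` is at most one.
    (K := 2 * B + ∑ i, W (Sum.inl r) i * (2 * B)) (fun n x => by
      rw [hdrift]
      refine (abs_sub _ _).trans (add_le_add (hdiff ?_ ?_) ?_)
      · exact abs_update_le hq (abs_state_le hq hB x n) _ _
      · exact abs_state_le hq hB x n _
      · rw [abs_mul, abs_of_pos (by linarith [hq.2])]
        refine (mul_le_of_le_one_left (abs_nonneg _) (by linarith [hq.1])).trans ?_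
        refine (Finset.abs_sum_le_sum_abs _ _).trans (Finset.sum_le_sum fun i _ => ?_)
        rw [abs_mul, abs_of_nonneg (hW _ _)]
        exact mul_le_mul_of_nonneg_left
          (hdiff (abs_state_le hq hB x n _) (abs_state_le hq hB x n _)) (hW _ _))
  filter_upwards [hlaw] with ω hω
  simp only [hdrift] at hω
  set X : ℕ → R ⊕ S → ℝ := state q x0 fun k => e k ω with hX
  have htel : ∀ n, ∑ u ∈ Finset.range n, (update q (X u) (e u ω) (Sum.inl r) - X u (Sum.inl r))
      = X n (Sum.inl r) - X 0 (Sum.inl r) :=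
    fun n => Finset.sum_range_sub (fun u => X u (Sum.inl r)) n
  have hends : Tendsto (fun n : ℕ => (X n (Sum.inl r) - X 0 (Sum.inl r)) / n) atTop (𝓝 0) := by
    refine squeeze_zero_norm (fun n => ?_) (tendsto_const_div_atTop_nhds_zero_nat (2 * B))
    rw [Real.norm_eq_abs, abs_div, Nat.abs_cast]
    gcongr
    exact hdiff (abs_state_le hq hB _ n _) (abs_state_le hq hB _ 0 _)
  have hq1 : 1 - q ≠ 0 := by linarith [hq.2]
  have hlim := (hends.sub hω).const_mul (1 - q)⁻¹
  rw [sub_zero, mul_zero] at hlim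
  refine hlim.congr fun n => ?_
  have hcomm : ∑ u ∈ Finset.range n, ∑ i, W (Sum.inl r) i * (X u i - X u (Sum.inl r))
      = ∑ i, W (Sum.inl r) i * (∑ u ∈ Finset.range n, X u i
        - ∑ u ∈ Finset.range n, X u (Sum.inl r)) := by
    rw [Finset.sum_comm]
    refine Finset.sum_congr rfl fun i _ => ?_
    rw [← Finset.mul_sum, Finset.sum_sub_distrib]
  rw [Finset.sum_sub_distrib, htel, ← Finset.mul_sum, hcomm, ← sub_div, sub_sub_cancel,
    mul_div_assoc, inv_mul_cancel_left₀ hq1, Finset.sum_div]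
  refine Finset.sum_congr rfl fun i _ => ?_
  rw [mul_div_assoc, sub_div]

end Model
end Gossip

/-! ### Affine recursion and the two-by-two equilibrium system -/

/-- Stochastic-approximation recursion with step size `a / t` and convergent coefficients: the
iterates converge to the zero of the limiting affine map. -/
theorem tendsto_of_affine_recursion {w γ b : ℕ → ℝ} {a γ' b' w' : ℝ} (ha : 0 < a) (hγ' : 0 < γ')
    (hγ : Tendsto γ atTop (𝓝 γ')) (hb : Tendsto b atTop (𝓝 b')) (hw' : γ' * w' + b' = 0)
    (hw : ∀ᶠ t : ℕ in atTop, w (t + 1) = w t - a / ((t : ℝ) + 1) * (γ t * w t + b t)) :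
    Tendsto w atTop (𝓝 w') := by
  rw [Metric.tendsto_atTop']
  intro ε hε
  set δ := ε / 2 with hδ
  have hδ0 : 0 < δ := by positivity
  -- At `w'` the affine map tends to zero, so its value is eventually dominated by `δ * γ t`.
  have herr : Tendsto (fun t => |γ t * w' + b t| - δ * γ t) atTop (𝓝 (0 - δ * γ')) := by
    have h1 := ((hγ.mul_const w').add hb).abs
    rw [hw', abs_zero] at h1
    exact h1.sub (hγ.const_mul δ)
  have herr' := herr.eventually_lt_const
    (show 0 - δ * γ' < 0 by rw [zero_sub, neg_lt_zero]; positivity)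
  have hhalf := hγ.eventually_const_lt (show γ' / 2 < γ' by linarith)
  have hsmall : ∀ᶠ t : ℕ in atTop, a / ((t : ℝ) + 1) * γ t < 1 := by
    have h1 : Tendsto (fun t : ℕ => a / ((t : ℝ) + 1) * γ t) atTop (𝓝 (0 * γ')) := by
      refine Tendsto.mul ?_ hγ
      have := (tendsto_one_div_add_atTop_nhds_zero_nat (𝕜 := ℝ)).const_mul a
      simpa [div_eq_mul_inv] using this
    rw [zero_mul] at h1
    exact h1.eventually_lt_const one_pos
  obtain ⟨N, hN⟩ := eventually_atTop.1 (hw.and (herr'.and (hhalf.and hsmall)))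
  set κ := a * (γ' / 2) with hκ
  have hκ0 : 0 < κ := by positivity
  set H : ℕ → ℝ := fun n => ∑ i ∈ Finset.range n, 1 / ((i : ℝ) + 1) with hH
  set v : ℕ → ℝ := fun t => max (|w t - w'| - δ) 0 with hv
  have hv0 : ∀ t, 0 ≤ v t := fun t => le_max_right _ _
  -- The excess `v` of the error over the tolerance `δ` contracts by `1 - c`, and `γ t > γ' / 2`
  -- gives `1 - c ≤ exp (-κ / (t + 1))`. Multiplied up, these factors tend to zero since `H`
  -- diverges.
  have hstep : ∀ t ≥ N, v (t + 1) ≤ Real.exp (-(κ * (1 / ((t : ℝ) + 1)))) * v t := by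
    intro t ht
    obtain ⟨h1, h2, h3, h4⟩ := hN t ht
    set c := a / ((t : ℝ) + 1) * γ t with hc
    have ht0 : 0 < a / ((t : ℝ) + 1) := by positivity
    have hle : 1 - c ≤ Real.exp (-(κ * (1 / ((t : ℝ) + 1)))) := by
      have h5 := Real.add_one_le_exp (-(κ * (1 / ((t : ℝ) + 1))))
      have h6 : κ * (1 / ((t : ℝ) + 1)) ≤ c := by
        rw [hc, hκ]
        calc a * (γ' / 2) * (1 / ((t : ℝ) + 1)) = a / ((t : ℝ) + 1) * (γ' / 2) := by ring
          _ ≤ _ := mul_le_mul_of_nonneg_left h3.le ht0.le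
      linarith
    have hu : w (t + 1) - w' = (1 - c) * (w t - w') - a / ((t : ℝ) + 1) * (γ t * w' + b t) := by
      rw [h1, hc]; ring
    have habs : |w (t + 1) - w'| ≤ (1 - c) * |w t - w'| + c * δ := by
      rw [hu]
      refine (abs_sub _ _).trans ?_
      rw [abs_mul, abs_mul, abs_of_pos (by linarith : 0 < 1 - c), abs_of_pos ht0]
      have : a / ((t : ℝ) + 1) * |γ t * w' + b t| ≤ a / ((t : ℝ) + 1) * (δ * γ t) :=
        mul_le_mul_of_nonneg_left (by linarith) ht0.le
      have h7 : c * δ = a / ((t : ℝ) + 1) * (δ * γ t) := by rw [hc]; ring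
      linarith
    refine max_le ?_ (mul_nonneg (Real.exp_pos _).le (hv0 t))
    calc |w (t + 1) - w'| - δ ≤ (1 - c) * (|w t - w'| - δ) := by linarith
      _ ≤ (1 - c) * v t := mul_le_mul_of_nonneg_left (le_max_left _ _) (by linarith)
      _ ≤ _ := mul_le_mul_of_nonneg_right hle (hv0 t)
  have hbound : ∀ t ≥ N, v t ≤ v N * Real.exp (κ * H N) * Real.exp (-(κ * H t)) := by
    intro t ht
    induction t, ht using Nat.le_induction with
    | base => rw [mul_assoc, ← Real.exp_add]; simp
    | succ t ht ih =>
      refine (hstep t ht).trans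
        ((mul_le_mul_of_nonneg_left ih (Real.exp_pos _).le).trans (le_of_eq ?_))
      rw [mul_left_comm, ← Real.exp_add]
      congr 2
      simp only [hH, Finset.sum_range_succ]
      ring
  have hexp : Tendsto (fun t => v N * Real.exp (κ * H N) * Real.exp (-(κ * H t))) atTop (𝓝 0) := by
    have h1 : Tendsto (fun t => κ * H t) atTop atTop :=
      Real.tendsto_sum_range_one_div_nat_succ_atTop.const_mul_atTop hκ0
    simpa using (Real.tendsto_exp_neg_atTop_nhds_zero.comp h1).const_mul
      (v N * Real.exp (κ * H N))
  obtain ⟨N', hN'⟩ := eventually_atTop.1 (hexp.eventually_lt_const hδ0)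
  refine ⟨max N N', fun t ht => ?_⟩
  have h1 := (hbound t (by omega)).trans_lt (hN' t (by omega))
  have h2 : |w t - w'| - δ ≤ v t := le_max_left _ _
  rw [Real.dist_eq]
  linarith

/-- The equilibrium equations of two communities with `rₖ` regular and `sₖ` stubborn agents have a
solution, and the order of its components is explicit. -/
theorem exists_community_equilibrium {r₁ r₂ s₁ s₂ ws wd : ℝ} (hr₁ : 0 < r₁) (hr₂ : 0 < r₂)
    (hs₁ : 0 < s₁) (hs₂ : 0 < s₂) (hws : 0 < ws) (hwd : 0 < wd) (a₁ a₂ : ℝ) :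
    ∃ m₁ m₂ : ℝ, ws * s₁ * (a₁ - m₁) + wd * r₂ * (m₂ - m₁) + wd * s₂ * (a₂ - m₁) = 0 ∧
      ws * s₂ * (a₂ - m₂) + wd * r₁ * (m₁ - m₂) + wd * s₁ * (a₁ - m₂) = 0 ∧
      (0 < (ws - wd) * (a₁ - a₂) → m₂ < m₁) := by
  -- The determinant of the system in the unknowns `m₁ - a₂` and `m₂ - a₂`; the witnesses come from
  -- Cramer's rule. Its `r₁ * r₂` terms cancel, leaving only positive ones.
  set Δ := ws ^ 2 * s₁ * s₂ + ws * wd * s₁ * (s₁ + r₁) + ws * wd * s₂ * (s₂ + r₂)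
    + wd ^ 2 * (s₁ * s₂ + r₁ * s₂ + r₂ * s₁) with hΔ
  have hΔ0 : 0 < Δ := by positivity
  refine ⟨a₂ + s₁ * (ws * (ws * s₂ + wd * (s₁ + r₁)) + wd ^ 2 * r₂) * (a₁ - a₂) / Δ,
    a₂ + s₁ * (wd * (ws * s₁ + wd * (s₂ + r₂)) + wd * r₁ * ws) * (a₁ - a₂) / Δ, ?_, ?_, ?_⟩
  · field_simp
    rw [hΔ]
    ring
  · field_simp
    rw [hΔ]
    ring
  · intro h
    refine add_lt_add_right ?_ _
    refine div_lt_div_of_pos_right ?_ hΔ0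
    -- This is exactly the difference of the two numerators.
    have h1 : 0 < s₁ * s₂ * (ws + wd) * ((ws - wd) * (a₁ - a₂)) := by positivity
    nlinarith

/-- In equilibrium, with `g = h₁ - n * h₂` and `k = wd + n * ws`, the weight `ws` solves
`g * ws + k * h₂ = 0`, and `g` does not vanish. -/
theorem community_equilibrium_gradient {r₁ r₂ s₁ s₂ ws wd a₁ a₂ m₁ m₂ n k : ℝ} (hr₁ : 0 < r₁)
    (hr₂ : 0 < r₂) (hs₁ : 0 < s₁) (hs₂ : 0 < s₂) (hws : 0 < ws) (hwd : 0 < wd) (ha : a₁ ≠ a₂)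
    (h₁ : ws * s₁ * (a₁ - m₁) + wd * r₂ * (m₂ - m₁) + wd * s₂ * (a₂ - m₁) = 0)
    (h₂ : ws * s₂ * (a₂ - m₂) + wd * r₁ * (m₁ - m₂) + wd * s₁ * (a₁ - m₂) = 0)
    (hk : wd + n * ws = k) (hk0 : k ≠ 0) :
    (s₁ * (m₁ - a₁) - n * ((r₂ + s₂) * m₁ - r₂ * m₂ - s₂ * a₂)) * ws
        + k * ((r₂ + s₂) * m₁ - r₂ * m₂ - s₂ * a₂) = 0 ∧
      s₁ * (m₁ - a₁) - n * ((r₂ + s₂) * m₁ - r₂ * m₂ - s₂ * a₂) ≠ 0 := by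
  have hsum : (s₁ * (m₁ - a₁) - n * ((r₂ + s₂) * m₁ - r₂ * m₂ - s₂ * a₂)) * ws
      + k * ((r₂ + s₂) * m₁ - r₂ * m₂ - s₂ * a₂) = 0 := by
    rw [← hk]
    -- Once `k` is expanded, the terms in `n` cancel and the equation of community one remains.
    linear_combination -h₁
  refine ⟨hsum, fun hg => ?_⟩
  -- If `g` vanished, so would `h₂` and then `h₁`, that is `m₁ = a₁`. The equation of community two
  -- then forces `m₂ = m₁`, and `h₂ = 0` gives `a₂ = m₁`.
  have hh₂ : (r₂ + s₂) * m₁ - r₂ * m₂ - s₂ * a₂ = 0 := by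
    rw [hg, zero_mul, zero_add] at hsum
    exact (mul_eq_zero.1 hsum).resolve_left hk0
  have hm₁ : m₁ = a₁ := by
    rw [hh₂, mul_zero, sub_zero] at hg
    linarith [(mul_eq_zero.1 hg).resolve_left hs₁.ne']
  subst hm₁
  have h3 : r₂ * (m₂ - m₁) = s₂ * (m₁ - a₂) := by linarith
  have h4 : (ws * s₂ + wd * (r₁ + s₁)) * (m₂ - m₁) = - (ws * s₂ * (m₁ - a₂)) := by linarith
  have h5 : (ws * s₂ + wd * (r₁ + s₁) + ws * r₂) * (m₂ - m₁) = 0 := by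
    linear_combination h4 + ws * h3
  have h6 : m₂ - m₁ = 0 := (mul_eq_zero.1 h5).resolve_left (by positivity)
  rw [h6, mul_zero] at h3
  exact ha (by linarith [(mul_eq_zero.1 h3.symm).resolve_left hs₂.ne'])

/-! ### Maximum principle and equilibrium between communities -/

namespace Gossip

theorem Label.ne_iff_eq {k l : Label} (hkl : k ≠ l) (c : Label) : c ≠ k ↔ c = l := by
  cases k <;> cases l <;> cases c <;> simp_all

section Equilibrium

variable {R S : Type*}

/-- The number of regular agents with label `k`, as a real number. -/
def regularCount [Fintype R] (c : R ⊕ S → Label) (k : Label) : ℝ := ((regularIn c k).card : ℝ)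

/-- The number of stubborn agents with label `k`, as a real number. -/
def stubbornCount [Fintype S] (c : R ⊕ S → Label) (k : Label) : ℝ := ((stubbornIn c k).card : ℝ)

theorem size_eq [Fintype R] [Fintype S] (c : R ⊕ S → Label) (k : Label) :
    size c k = regularCount c k + stubbornCount c k := by
  simp only [size, regularCount, stubbornCount, regularIn, stubbornIn, Finset.card_filter,
    Fintype.sum_sum_type]
  push_cast
  rfl

theorem regularCount_pos [Fintype R] {c : R ⊕ S → Label} {k : Label}
    (h : ∃ r : R, c (Sum.inl r) = k) :
    0 < regularCount c k := by
  obtain ⟨r, hr⟩ := h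
  exact Nat.cast_pos.2 (Finset.card_pos.2 ⟨r, by simp [regularIn, hr]⟩)

theorem stubbornCount_pos [Fintype S] {c : R ⊕ S → Label} {k : Label}
    (h : ∃ s : S, c (Sum.inr s) = k) :
    0 < stubbornCount c k := by
  obtain ⟨s, hs⟩ := h
  exact Nat.cast_pos.2 (Finset.card_pos.2 ⟨s, by simp [stubbornIn, hs]⟩)

theorem sum_stubbornIn [Fintype S] {c : R ⊕ S → Label} {k : Label}
    (h : 0 < stubbornCount c k) (xs : S → ℝ) :
    ∑ s ∈ stubbornIn c k, xs s = stubbornCount c k * stubbornAvg c xs k :=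
  (mul_div_cancel₀ _ h.ne').symm

theorem sum_regularIn [Fintype R] (c : R ⊕ S → Label) (m : Label → ℝ) (k : Label) :
    ∑ r ∈ regularIn c k, m (c (Sum.inl r)) = regularCount c k * m k := by
  rw [Finset.sum_congr rfl fun r hr => by rw [(Finset.mem_filter.1 hr).2], Finset.sum_const,
    nsmul_eq_mul, regularCount]

variable [Fintype R] [Fintype S]

/-- Discrete maximum principle: a function that vanishes at the stubborn agents is bounded by its
Laplacian at the regular agents, with a constant that bounds the total weight to the stubborn
agents from below. -/
theorem mul_abs_le_sum_abs_laplacian {W : Matrix (R ⊕ S) (R ⊕ S) ℝ} (hW : ∀ i k, 0 ≤ W i k)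
    {κ : ℝ} (hκ : ∀ r, κ ≤ ∑ s, W (Sum.inl r) (Sum.inr s)) (hκ0 : 0 ≤ κ) {z : R ⊕ S → ℝ}
    (hz : ∀ s, z (Sum.inr s) = 0) (r : R) :
    κ * |z (Sum.inl r)| ≤ ∑ r', |∑ i, W (Sum.inl r') i * (z i - z (Sum.inl r'))| := by
  have : Nonempty R := ⟨r⟩
  -- At a maximiser of `|z|` the regular neighbours cannot outweigh their own total weight, so the
  -- weight to the stubborn agents must be balanced by the Laplacian.
  obtain ⟨r', hr'⟩ := Finite.exists_max fun r => |z (Sum.inl r)|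
  have hlap : (∑ s, W (Sum.inl r') (Sum.inr s)) * z (Sum.inl r')
      + (∑ k, W (Sum.inl r') (Sum.inl k)) * z (Sum.inl r')
      = ∑ k, W (Sum.inl r') (Sum.inl k) * z (Sum.inl k)
        - ∑ i, W (Sum.inl r') i * (z i - z (Sum.inl r')) := by
    simp only [Fintype.sum_sum_type, hz, mul_sub, Finset.sum_sub_distrib, Finset.sum_mul]
    simp
    ring
  have hreg : |∑ k, W (Sum.inl r') (Sum.inl k) * z (Sum.inl k)|
      ≤ (∑ k, W (Sum.inl r') (Sum.inl k)) * |z (Sum.inl r')| := by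
    refine (Finset.abs_sum_le_sum_abs _ _).trans ?_
    rw [Finset.sum_mul]
    refine Finset.sum_le_sum fun k _ => ?_
    rw [abs_mul, abs_of_nonneg (hW _ _)]
    exact mul_le_mul_of_nonneg_left (hr' k) (hW _ _)
  have htot : (∑ s, W (Sum.inl r') (Sum.inr s)) * |z (Sum.inl r')|
      + (∑ k, W (Sum.inl r') (Sum.inl k)) * |z (Sum.inl r')|
      ≤ |∑ k, W (Sum.inl r') (Sum.inl k) * z (Sum.inl k)|
        + |∑ i, W (Sum.inl r') i * (z i - z (Sum.inl r'))| := by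
    refine le_trans (le_of_eq ?_) (abs_sub _ _)
    have h0 : 0 ≤ ∑ s, W (Sum.inl r') (Sum.inr s) + ∑ k, W (Sum.inl r') (Sum.inl k) :=
      add_nonneg (Finset.sum_nonneg fun _ _ => hW _ _) (Finset.sum_nonneg fun _ _ => hW _ _)
    rw [← hlap, ← add_mul, ← add_mul, abs_mul, abs_of_nonneg h0]
  calc κ * |z (Sum.inl r)| ≤ κ * |z (Sum.inl r')| := mul_le_mul_of_nonneg_left (hr' r) hκ0
    _ ≤ (∑ s, W (Sum.inl r') (Sum.inr s)) * |z (Sum.inl r')| :=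
        mul_le_mul_of_nonneg_right (hκ r') (abs_nonneg _)
    _ ≤ |∑ i, W (Sum.inl r') i * (z i - z (Sum.inl r'))| := by linarith
    _ ≤ _ := Finset.single_le_sum (f := fun r' => |∑ i, W (Sum.inl r') i * (z i - z (Sum.inl r'))|)
        (fun _ _ => abs_nonneg _) (Finset.mem_univ r')

/-- The state vector with the states `xs` of the stubborn agents in which the regular agents of
community `k` have the state `m k`. -/
def profile (c : R ⊕ S → Label) (m : Label → ℝ) (xs : S → ℝ) : R ⊕ S → ℝ :=
  Sum.elim (fun r => m (c (Sum.inl r))) xs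

/-- Regular agents of the same community share the value `m k` and drop out, as does the zero
diagonal. The result depends on `r` only through its community, which reduces harmonicity to two
equations. -/
theorem sum_interactionMatrix_profile [DecidableEq R] [DecidableEq S] {c : R ⊕ S → Label}
    (ws wd : ℝ) (m : Label → ℝ) (xs : S → ℝ) (hs : ∀ k, 0 < stubbornCount c k) {r : R}
    {k l : Label} (hkl : k ≠ l) (hr : c (Sum.inl r) = k) :
    ∑ i, interactionMatrix c ws wd (Sum.inl r) i * (profile c m xs i - profile c m xs (Sum.inl r))
      = ws * stubbornCount c k * (stubbornAvg c xs k - m k)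
        + wd * regularCount c l * (m l - m k)
        + wd * stubbornCount c l * (stubbornAvg c xs l - m k) := by
  have hterm : ∀ i, interactionMatrix c ws wd (Sum.inl r) i
      * (profile c m xs i - profile c m xs (Sum.inl r))
      = (if c i = k then ws * (profile c m xs i - m k) else 0)
        + (if c i = l then wd * (profile c m xs i - m k) else 0) := by
    intro i
    have hpr : profile c m xs (Sum.inl r) = m k := by rw [← hr]; rfl
    rw [hpr]
    by_cases hi : Sum.inl r = i
    · subst hi
      rw [hpr]
      simp
    · by_cases hk : c i = k
      · simp [interactionMatrix, hi, hr, hk, hkl]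
      · have hl := (Label.ne_iff_eq hkl _).1 hk
        simp [interactionMatrix, hi, hr, hl, hkl, hkl.symm]
  simp only [hterm, Fintype.sum_sum_type]
  simp only [Finset.sum_add_distrib, ← Finset.sum_filter,
    ← Finset.mul_sum, Finset.sum_sub_distrib]
  have hreg := sum_regularIn c m
  have hst := fun k => sum_stubbornIn (hs k) xs
  simp only [regularIn, stubbornIn] at hreg hst
  simp only [profile, Sum.elim_inl, Sum.elim_inr, hreg, hst, Finset.sum_const, nsmul_eq_mul]
  simp only [regularCount, stubbornCount, regularIn, stubbornIn]
  ring

/-- `m` satisfies the equilibrium equations of the two communities. -/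
def IsEquilibrium (c : R ⊕ S → Label) (ws wd : ℝ) (xs : S → ℝ) (m : Label → ℝ) : Prop :=
  ∀ k l, k ≠ l → ws * stubbornCount c k * (stubbornAvg c xs k - m k)
    + wd * regularCount c l * (m l - m k)
    + wd * stubbornCount c l * (stubbornAvg c xs l - m k) = 0

theorem exists_isEquilibrium {c : R ⊕ S → Label} {ws wd : ℝ} (hws : 0 < ws) (hwd : 0 < wd)
    (xs : S → ℝ) (hr : ∀ k, 0 < regularCount c k) (hs : ∀ k, 0 < stubbornCount c k)
    (hpos : 0 < (ws - wd) * (stubbornAvg c xs .one - stubbornAvg c xs .two)) :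
    ∃ m, IsEquilibrium c ws wd xs m ∧ m .two < m .one := by
  obtain ⟨m₁, m₂, h₁, h₂, h⟩ := exists_community_equilibrium (hr .one) (hr .two) (hs .one)
    (hs .two) hws hwd (stubbornAvg c xs .one) (stubbornAvg c xs .two)
  refine ⟨fun k => match k with | .one => m₁ | .two => m₂, fun k l hkl => ?_, h hpos⟩
  cases k <;> cases l
  · exact absurd rfl hkl
  · exact h₁
  · exact h₂
  · exact absurd rfl hkl

end Equilibrium

/-! ### Limits of the recovery and estimation steps -/

section Limits

variable {R S : Type*} [Fintype R]

/-- If the time averages converge to distinct community values, the recovery step is eventually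
exact. -/
theorem eventually_recover_eq {c : R ⊕ S → Label} {j : S → R}
    (hj : ∀ i, c (Sum.inr i) = c (Sum.inl (j i))) (hr : ∀ k, 0 < regularCount c k)
    {m : Label → ℝ} (hm : m .two < m .one) {s : ℕ → R → ℝ}
    (hs : ∀ r, Tendsto (fun t => s t r) atTop (𝓝 (m (c (Sum.inl r))))) :
    ∀ᶠ t in atTop, recover j (s t) = c := by
  have hcount : (Fintype.card R : ℝ) = regularCount c .one + regularCount c .two := by
    have h1 := Finset.card_filter_add_card_filter_not (s := (Finset.univ : Finset R))
      (fun r => c (Sum.inl r) = .one)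
    simp only [Label.ne_iff_eq (show Label.one ≠ .two by decide)] at h1
    rw [← Finset.card_univ, ← h1]
    simp [regularCount, regularIn]
  have hsum : ∑ r, m (c (Sum.inl r))
      = regularCount c .one * m .one + regularCount c .two * m .two := by
    have h1 := Finset.sum_filter_add_sum_filter_not (Finset.univ : Finset R)
      (fun r => c (Sum.inl r) = .one) fun r => m (c (Sum.inl r))
    simp only [Label.ne_iff_eq (show Label.one ≠ .two by decide)] at h1
    rw [← h1, ← sum_regularIn c m .one, ← sum_regularIn c m .two, regularIn, regularIn]
  have hR : 0 < (Fintype.card R : ℝ) := by rw [hcount]; exact add_pos (hr _) (hr _)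
  have hmean : Tendsto (fun t => (∑ r, s t r) / (Fintype.card R : ℝ)) atTop
      (𝓝 ((∑ r, m (c (Sum.inl r))) / (Fintype.card R : ℝ))) :=
    (tendsto_finsetSum _ fun r _ => hs r).div_const _
  -- The mean is a convex combination of the two community values with both weights positive, hence
  -- strictly between them.
  have hlt1 : (∑ r, m (c (Sum.inl r))) / (Fintype.card R : ℝ) < m .one := by
    rw [div_lt_iff₀ hR, hsum, hcount]
    nlinarith [hr .two]
  have hlt2 : m .two < (∑ r, m (c (Sum.inl r))) / (Fintype.card R : ℝ) := by
    rw [lt_div_iff₀ hR, hsum, hcount]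
    nlinarith [hr .one]
  have hlabel : ∀ᶠ t in atTop, ∀ r, regularLabel (s t) r = c (Sum.inl r) := by
    refine eventually_all.2 fun r => ?_
    cases hc : c (Sum.inl r) with
    | one =>
      have h1 := hs r
      rw [hc] at h1
      filter_upwards [hmean.eventually_lt h1 hlt1] with t ht
      rw [regularLabel, if_pos ht]
    | two =>
      have h1 := hs r
      rw [hc] at h1
      filter_upwards [h1.eventually_lt hmean hlt2] with t ht
      rw [regularLabel, if_neg ht.not_gt]
  filter_upwards [hlabel] with t ht
  ext i
  cases i with
  | inl r => exact ht r
  | inr i => rw [hj]; exact ht (j i)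

variable [Fintype S]

theorem continuous_h₁ (c : R ⊕ S → Label) (xs : S → ℝ) : Continuous fun s => h₁ c s xs := by
  unfold h₁
  fun_prop

theorem continuous_h₂ (c : R ⊕ S → Label) (xs : S → ℝ) : Continuous fun s => h₂ c s xs := by
  unfold h₂
  fun_prop

theorem continuous_g (c : R ⊕ S → Label) (xs : S → ℝ) : Continuous fun s => g c s xs :=
  (continuous_h₁ c xs).sub (continuous_const.mul (continuous_h₂ c xs))

/-- The estimates converge as soon as the labels are eventually exact and the time averages
converge to the equilibrium. -/
theorem tendsto_estimates {c : R ⊕ S → Label} {ws wd : ℝ} (hws : 0 < ws) (hwd : 0 < wd)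
    {xs : S → ℝ} (hr : ∀ k, 0 < regularCount c k) (hs : ∀ k, 0 < stubbornCount c k)
    (havg : stubbornAvg c xs .one ≠ stubbornAvg c xs .two)
    (htot : (size c .one * (size c .one - 1) + size c .two * (size c .two - 1)) * ws
      + 2 * size c .one * size c .two * wd = 2)
    {m : Label → ℝ} (hm : IsEquilibrium c ws wd xs m) {j : S → R} {a : ℝ} (ha : 0 < a)
    {x : ℕ → R → ℝ} (hrec : ∀ᶠ t in atTop, recover j (timeAvg x t) = c)
    (hx : ∀ r, Tendsto (fun t => timeAvg x t r) atTop (𝓝 (m (c (Sum.inl r)))))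
    (w0 w0' : ℝ) (alt alt' : ℕ → ℝ) :
    Tendsto (fun t => (wsHat j xs a w0 alt x t, wdHat j w0' alt' x (wsHat j xs a w0 alt x) t))
      atTop (𝓝 (ws, wd)) := by
  set s' : R → ℝ := fun r => m (c (Sum.inl r)) with hs'
  have hn : ∀ k, 0 < size c k := fun k => by rw [size_eq]; exact add_pos (hr k) (hs k)
  have hn1 := hn .one
  have hn2 := hn .two
  set n := (size c .one ^ 2 + size c .two ^ 2 - size c .one - size c .two)
    / (2 * size c .one * size c .two) with hnn
  -- The normalisation of the probabilities divided by `2 * n₁ * n₂`.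
  have hk : wd + n * ws = 1 / (size c .one * size c .two) := by
    rw [hnn]
    field_simp
    linarith
  have hone : ((regularIn c .one).card : ℝ) ≠ 0 := (hr .one).ne'
  have hh₁ : h₁ c s' xs = stubbornCount c .one * (m .one - stubbornAvg c xs .one) := by
    rw [h₁, hs', sum_regularIn, sum_stubbornIn (hs _), regularCount, stubbornCount]
    field_simp
  have hh₂ : h₂ c s' xs = (regularCount c .two + stubbornCount c .two) * m .one
      - regularCount c .two * m .two - stubbornCount c .two * stubbornAvg c xs .two := by
    rw [h₂, hs', sum_regularIn, sum_regularIn, sum_stubbornIn (hs _), size_eq]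
    rw [show regularCount c .one = ((regularIn c .one).card : ℝ) from rfl]
    field_simp
  obtain ⟨hroot, hg0⟩ := community_equilibrium_gradient (hr .one) (hr .two) (hs .one) (hs .two)
    hws hwd havg (hm .one .two (by decide)) (hm .two .one (by decide)) hk (by positivity)
  rw [← hh₁, ← hh₂, show h₁ c s' xs - n * h₂ c s' xs = g c s' xs from rfl] at hroot hg0
  have hxt : Tendsto (fun t => timeAvg x (t + 1)) atTop (𝓝 s') :=
    (tendsto_pi_nhds.2 hx).comp (tendsto_add_atTop_nat 1)
  have hgt : Tendsto (fun t => g c (timeAvg x (t + 1)) xs) atTop (𝓝 (g c s' xs)) :=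
    ((continuous_g c xs).tendsto _).comp hxt
  have hht : Tendsto (fun t => h₂ c (timeAvg x (t + 1)) xs) atTop (𝓝 (h₂ c s' xs)) :=
    ((continuous_h₂ c xs).tendsto _).comp hxt
  -- Because the limit of `g` is nonzero, its sign freezes. The coefficient `sign g * g` then tends
  -- to a positive number, as the affine recursion needs.
  have hsign : ∀ᶠ t in atTop,
      Real.sign (g c (timeAvg x (t + 1)) xs) = Real.sign (g c s' xs) := by
    rcases hg0.lt_or_gt with h | h
    · filter_upwards [hgt.eventually_lt_const h] with t ht
      rw [Real.sign_of_neg ht, Real.sign_of_neg h]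
    · filter_upwards [hgt.eventually_const_lt h] with t ht
      rw [Real.sign_of_pos ht, Real.sign_of_pos h]
  have hrec' : ∀ᶠ t in atTop, recover j (timeAvg x (t + 1)) = c :=
    (tendsto_add_atTop_nat 1).eventually hrec
  have hne : (regularIn c .one).Nonempty := by
    rw [← Finset.card_pos]
    exact Nat.cast_pos.1 (hr .one)
  have hw : Tendsto (wsHat j xs a w0 alt x) atTop (𝓝 ws) := by
    refine tendsto_of_affine_recursion (a := a)
      (γ := fun t => Real.sign (g c s' xs) * g c (timeAvg x (t + 1)) xs)
      (b := fun t => Real.sign (g c s' xs)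
        * (h₂ c (timeAvg x (t + 1)) xs / (size c .one * size c .two)))
      ha (Real.sign_mul_pos_of_ne_zero _ hg0) (hgt.const_mul _)
      ((hht.div_const _).const_mul _) ?_ ?_
    · rw [mul_assoc, ← mul_add, mul_eq_zero]
      right
      rw [← hroot]
      ring
    · filter_upwards [hsign, hrec'] with t ht hct
      rw [wsHat, hct, if_pos hne, wsStep, ht]
      push_cast
      ring
  refine hw.prodMk_nhds ?_
  rw [← tendsto_add_atTop_iff_nat 1]
  have hwd' : Tendsto (fun t => wdOf c (wsHat j xs a w0 alt x (t + 1))) atTop (𝓝 (wdOf c ws)) := by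
    have h1 : Continuous (wdOf c) := by
      unfold wdOf
      fun_prop
    exact (h1.tendsto _).comp (hw.comp (tendsto_add_atTop_nat 1))
  have hval : wdOf c ws = wd := by
    rw [wdOf, div_eq_iff (by positivity)]
    linarith
  rw [hval] at hwd'
  refine hwd'.congr' ?_
  filter_upwards [hrec'] with t hct
  rw [wdHat, hct, if_pos hne]

end Limits

end Gossip

/-! ### Measurable recovery time and almost sure convergence -/

/-- A family of events that almost surely holds from some time on holds after a measurable random
time. -/
theorem exists_measurable_time {Ω : Type*} [MeasurableSpace Ω] {μ : Measure Ω} {A : ℕ → Set Ω}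
    (hA : ∀ t, MeasurableSet (A t)) (h : ∀ᵐ ω ∂μ, ∀ᶠ t in atTop, ω ∈ A t) :
    ∃ T : Ω → ℕ, Measurable T ∧ (∀ ω, 0 < T ω) ∧ ∀ᵐ ω ∂μ, ∀ t, T ω < t → ω ∈ A t := by
  classical
  have hB : ∀ n, MeasurableSet (⋂ t, ⋂ _ : n ≤ t, A t) := fun n =>
    MeasurableSet.iInter fun t => MeasurableSet.iInter fun _ => hA t
  -- The complement is added so that a first index exists for every `ω`, also on the null set where
  -- the events fail infinitely often.
  have hex : ∀ ω, ∃ n, ω ∈ (⋂ t, ⋂ _ : n ≤ t, A t) ∪ (⋃ k, ⋂ t, ⋂ _ : k ≤ t, A t)ᶜ := by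
    intro ω
    by_cases hω : ω ∈ ⋃ k, ⋂ t, ⋂ _ : k ≤ t, A t
    · obtain ⟨n, hn⟩ := Set.mem_iUnion.1 hω
      exact ⟨n, Or.inl hn⟩
    · exact ⟨0, Or.inr hω⟩
  refine ⟨fun ω => Nat.find (hex ω) + 1, ?_, fun ω => Nat.succ_pos _, ?_⟩
  · exact (measurable_find hex fun n =>
      (hB n).union (MeasurableSet.iUnion hB).compl).add_const 1
  · filter_upwards [h] with ω hω t ht
    obtain ⟨n, hn⟩ := eventually_atTop.1 hω
    rcases Nat.find_spec (hex ω) with h1 | h1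
    · exact Set.mem_iInter₂.1 h1 t (by omega)
    · exact absurd (Set.mem_iUnion.2 ⟨n, Set.mem_iInter₂.2 hn⟩) h1

namespace Gossip

variable {R S Ω : Type*} [Fintype R] [Fintype S] [DecidableEq R] [DecidableEq S]
  [MeasurableSpace Ω] {μ : Measure Ω}

/-- The event is decided by finitely many edges, each taking finitely many values. -/
theorem IsEdgeSelection.measurableSet_recover_eq {W : Matrix (R ⊕ S) (R ⊕ S) ℝ}
    {e : ℕ → Ω → Sym2 (R ⊕ S)} (he : IsEdgeSelection μ W e) [Nonempty R] (q : ℝ)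
    (x0 : R ⊕ S → ℝ) (j : S → R) (c : R ⊕ S → Label) (t : ℕ) :
    MeasurableSet {ω | recover j
      (timeAvg (fun t r => state q x0 (fun u => e u ω) t (Sum.inl r)) t) = c} := by
  classical
  let _ : MeasurableSpace (Sym2 (R ⊕ S)) := ⊤
  have : DiscreteMeasurableSpace (Sym2 (R ⊕ S)) := ⟨fun _ => trivial⟩
  have : Nonempty (Sym2 (R ⊕ S)) :=
    ⟨s(Sum.inl (Classical.arbitrary R), Sum.inl (Classical.arbitrary R))⟩
  have hdep : DependsOnFirst t fun x : ℕ → Sym2 (R ⊕ S) =>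
      if recover j (timeAvg (fun t r => state q x0 x t (Sum.inl r)) t) = c then (1 : ℝ) else 0 := by
    intro x y hxy
    have h : timeAvg (fun t r => state q x0 x t (Sum.inl r)) t
        = timeAvg (fun t r => state q x0 y t (Sum.inl r)) t := by
      ext r
      rw [timeAvg_eq, timeAvg_eq]
      congr 1
      refine Finset.sum_congr rfl fun u hu => dependsOnFirst_state q x0 u _ x y fun k hk => hxy k ?_
      have := Finset.mem_range.1 hu
      omega
    simp only [h]
  have hm := hdep.measurable he.measurable_top (measurableSet_singleton (1 : ℝ))
  convert hm using 1
  ext ω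
  simp

theorem interactionMatrix_nonneg {R S : Type*} [DecidableEq R] [DecidableEq S] {C : R ⊕ S → Label}
    {ws wd : ℝ} (hws : 0 ≤ ws) (hwd : 0 ≤ wd)
    (i k : R ⊕ S) : 0 ≤ interactionMatrix C ws wd i k := by
  unfold interactionMatrix
  split_ifs <;> simp [hws, hwd]

/-- The time averages of the regular states converge almost surely to the equilibrium values of
their communities. -/
theorem IsEdgeSelection.tendsto_timeAvg [IsProbabilityMeasure μ] {C : R ⊕ S → Label} {ws wd q : ℝ}
    (hws : 0 < ws) (hwd : 0 < wd) (x0 : R ⊕ S → ℝ) (hq : q ∈ Set.Ico (0 : ℝ) 1)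
    (hst : ∀ k, ∃ s : S, C (Sum.inr s) = k) {e : ℕ → Ω → Sym2 (R ⊕ S)}
    (he : IsEdgeSelection μ (interactionMatrix C ws wd) e) {m : Label → ℝ}
    (hm : IsEquilibrium C ws wd (fun s => x0 (Sum.inr s)) m) :
    ∀ᵐ ω ∂μ, ∀ r, Tendsto (fun t =>
      timeAvg (fun t r => state q x0 (fun u => e u ω) t (Sum.inl r)) t r) atTop
      (𝓝 (m (C (Sum.inl r)))) := by
  have hW := interactionMatrix_nonneg (C := C) hws.le hwd.le
  filter_upwards [ae_all_iff.2 fun r => he.tendsto_laplacian_avg hq x0 hW r] with ω hω r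
  set W := interactionMatrix C ws wd with hWdef
  set xs : S → ℝ := fun s => x0 (Sum.inr s) with hxs
  set avg : ℕ → R ⊕ S → ℝ := fun n i =>
    (∑ u ∈ Finset.range n, state q x0 (fun k => e k ω) u i) / (n : ℝ) with havg
  set z : ℕ → R ⊕ S → ℝ := fun n i => avg n i - profile C m xs i with hz
  -- The shift matters: the average over zero terms is `0 / 0 = 0`, not the stubborn state. It also
  -- matches `timeAvg` at `t`, which averages `t + 1` terms.
  have hz0 : ∀ n : ℕ, ∀ s, z (n + 1) (Sum.inr s) = 0 := by
    intro n s
    have hn : ((n : ℝ) + 1) ≠ 0 := by positivity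
    simp only [hz, havg, profile, state_inr, Finset.sum_const, Finset.card_range, nsmul_eq_mul,
      Sum.elim_inr, hxs]
    push_cast
    field_simp
    ring
  -- The equilibrium profile is harmonic at the regular agents, so subtracting it leaves the
  -- Laplacian unchanged there.
  have hlap : ∀ n r', ∑ i, W (Sum.inl r') i * (z n i - z n (Sum.inl r'))
      = ∑ i, W (Sum.inl r') i * (avg n i - avg n (Sum.inl r')) := by
    intro n r'
    obtain ⟨l, hl⟩ : ∃ l, C (Sum.inl r') ≠ l := by
      cases C (Sum.inl r')
      · exact ⟨.two, by decide⟩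
      · exact ⟨.one, by decide⟩
    have h1 := sum_interactionMatrix_profile ws wd m xs (fun k => stubbornCount_pos (hst k)) hl rfl
    rw [hm _ _ hl, ← hWdef] at h1
    have h2 : ∀ i, W (Sum.inl r') i * (z n i - z n (Sum.inl r'))
        = W (Sum.inl r') i * (avg n i - avg n (Sum.inl r'))
          - W (Sum.inl r') i * (profile C m xs i - profile C m xs (Sum.inl r')) := by
      intro i
      simp only [hz]
      ring
    rw [Finset.sum_congr rfl fun i _ => h2 i, Finset.sum_sub_distrib, h1, sub_zero]
  have hκ : ∀ r, min ws wd ≤ ∑ s, W (Sum.inl r) (Sum.inr s) := by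
    intro r
    obtain ⟨s, -⟩ := hst .one
    refine le_trans ?_ (Finset.single_le_sum (f := fun s => W (Sum.inl r) (Sum.inr s))
      (fun _ _ => hW _ _) (Finset.mem_univ s))
    simp only [hWdef, interactionMatrix, reduceCtorEq, if_false]
    split_ifs <;> simp
  have hκ0 : 0 < min ws wd := lt_min hws hwd
  have hlim : Tendsto (fun n => z (n + 1) (Sum.inl r)) atTop (𝓝 0) := by
    have hsum : Tendsto (fun n => (∑ r', |∑ i, W (Sum.inl r') i *
        (avg (n + 1) i - avg (n + 1) (Sum.inl r'))|) / min ws wd) atTop (𝓝 0) := by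
      have h1 := (tendsto_finsetSum Finset.univ fun r' _ =>
        ((hω r').comp (tendsto_add_atTop_nat 1)).abs).div_const (min ws wd)
      simp only [abs_zero, Finset.sum_const_zero, zero_div] at h1
      exact h1
    refine squeeze_zero_norm (fun n => ?_) hsum
    rw [Real.norm_eq_abs, le_div_iff₀ hκ0, mul_comm]
    simpa only [hlap] using mul_abs_le_sum_abs_laplacian hW hκ hκ0.le (hz0 n) r
  have h2 := hlim.add_const (m (C (Sum.inl r)))
  rw [zero_add] at h2
  refine h2.congr fun n => ?_
  rw [timeAvg_eq]
  simp only [hz, havg, profile, Sum.elim_inl, sub_add_cancel]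

/-- When the communities are numbered so that `(ws - wd) * (x̄₁ - x̄₂)` is positive, almost surely
the recovered labels are eventually exact and the estimates converge. -/
theorem ae_recover_eq_and_tendsto_estimates [IsProbabilityMeasure μ] {C : R ⊕ S → Label}
    {ws wd q : ℝ} {x0 : R ⊕ S → ℝ} (hq : q ∈ Set.Ico (0 : ℝ) 1)
    (hcomm : CommunityAssumption C ws wd x0)
    (hstub : StubbornAssumption C (fun s => x0 (Sum.inr s)))
    {e : ℕ → Ω → Sym2 (R ⊕ S)} (he : IsEdgeSelection μ (interactionMatrix C ws wd) e)
    {j : S → R} (hj : ∀ i, C (Sum.inr i) = C (Sum.inl (j i))) {a : ℝ} (ha : 0 < a)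
    (hpos : 0 < (ws - wd) * (stubbornAvg C (fun s => x0 (Sum.inr s)) .one
      - stubbornAvg C (fun s => x0 (Sum.inr s)) .two))
    (ws0 wd0 : Ω → ℝ) (alts altd : Ω → ℕ → ℝ) :
    let X : Ω → ℕ → R → ℝ := fun ω t r => state q x0 (fun u => e u ω) t (Sum.inl r)
    let ws' : Ω → ℕ → ℝ :=
      fun ω => wsHat j (fun s => x0 (Sum.inr s)) a (ws0 ω) (alts ω) (X ω)
    let wd' : Ω → ℕ → ℝ := fun ω => wdHat j (wd0 ω) (altd ω) (X ω) (ws' ω)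
    ∀ᵐ ω ∂μ, (∀ᶠ t in atTop, recover j (timeAvg (X ω) t) = C) ∧
      Tendsto (fun t => (ws' ω t, wd' ω t)) atTop (𝓝 (ws, wd)) := by
  intro X ws' wd'
  have hr : ∀ k, 0 < regularCount C k := fun k => regularCount_pos (hcomm.exists_regular k)
  have hs : ∀ k, 0 < stubbornCount C k := fun k => stubbornCount_pos (hstub.exists_stubborn k)
  obtain ⟨m, hm, hlt⟩ := exists_isEquilibrium hcomm.ws_pos hcomm.wd_pos _ hr hs hpos
  filter_upwards [he.tendsto_timeAvg hcomm.ws_pos hcomm.wd_pos x0 hq hstub.exists_stubborn hm]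
    with ω hω
  have hrec := eventually_recover_eq hj hr hlt hω
  exact ⟨hrec, tendsto_estimates hcomm.ws_pos hcomm.wd_pos hr hs hstub.avg_ne hcomm.total hm ha
    hrec hω _ _ _ _⟩

/-! ### Relabelling symmetry and the conclusion -/

theorem swap_comp_eq_iff {R S : Type*} (C : R ⊕ S → Label) (i : R ⊕ S) (k : Label) :
    (Equiv.swap Label.one Label.two ∘ C) i = k ↔ C i = Equiv.swap Label.one Label.two k := by
  rw [Function.comp_apply, Equiv.swap_apply_eq_iff]

theorem size_swap_comp {R S : Type*} [Fintype R] [Fintype S] (C : R ⊕ S → Label)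
    (k : Label) :
    size (Equiv.swap Label.one Label.two ∘ C) k = size C (Equiv.swap Label.one Label.two k) := by
  simp only [size, swap_comp_eq_iff]

theorem stubbornAvg_swap_comp {R S : Type*} [Fintype S] (C : R ⊕ S → Label)
    (xs : S → ℝ) (k : Label) :
    stubbornAvg (Equiv.swap Label.one Label.two ∘ C) xs k
      = stubbornAvg C xs (Equiv.swap Label.one Label.two k) := by
  simp only [stubbornAvg, stubbornIn, swap_comp_eq_iff]

/-- The entries only test equality of labels, and `σ` is injective. Thus the law of the edges cannot
distinguish the two numberings. -/
theorem interactionMatrix_comp {R S : Type*} [DecidableEq R] [DecidableEq S]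
    (C : R ⊕ S → Label) (ws wd : ℝ) (σ : Equiv.Perm Label) :
    interactionMatrix (σ ∘ C) ws wd = interactionMatrix C ws wd := by
  ext i k
  simp [interactionMatrix]

theorem CommunityAssumption.swap {R S : Type*} [Fintype R] [Fintype S] {C : R ⊕ S → Label}
    {ws wd : ℝ} {x0 : R ⊕ S → ℝ} (h : CommunityAssumption C ws wd x0) :
    CommunityAssumption (Equiv.swap Label.one Label.two ∘ C) ws wd x0 where
  exists_regular k := by
    simpa only [swap_comp_eq_iff] using h.exists_regular (Equiv.swap Label.one Label.two k)
  ws_pos := h.ws_pos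
  wd_pos := h.wd_pos
  ws_ne_wd := h.ws_ne_wd
  total := by
    rw [size_swap_comp, size_swap_comp, Equiv.swap_apply_left, Equiv.swap_apply_right]
    linarith [h.total]
  init_mem := h.init_mem

theorem StubbornAssumption.swap {R S : Type*} [Fintype S] {C : R ⊕ S → Label} {xs : S → ℝ}
    (h : StubbornAssumption C xs) :
    StubbornAssumption (Equiv.swap Label.one Label.two ∘ C) xs where
  exists_stubborn k := by
    simpa only [swap_comp_eq_iff] using h.exists_stubborn (Equiv.swap Label.one Label.two k)
  avg_ne := by
    rw [stubbornAvg_swap_comp, stubbornAvg_swap_comp, Equiv.swap_apply_left,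
      Equiv.swap_apply_right]
    exact h.avg_ne.symm

end Gossip

theorem theorem2 {R S Ω : Type*} [Fintype R] [Fintype S] [DecidableEq R] [DecidableEq S]
    [MeasurableSpace Ω] (μ : Measure Ω) [IsProbabilityMeasure μ]
    -- the gossip model: communities, interaction probabilities, averaging weight, initial state
    (C : R ⊕ S → Label) (ws wd q : ℝ) (x0 : R ⊕ S → ℝ) (hq : q ∈ Set.Ico (0 : ℝ) 1)
    (hcomm : CommunityAssumption C ws wd x0)
    (hstub : StubbornAssumption C (fun s => x0 (Sum.inr s)))
    (e : ℕ → Ω → Sym2 (R ⊕ S)) (he : IsEdgeSelection μ (interactionMatrix C ws wd) e)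
    -- every stubborn agent `i` is known to be in the community of the regular agent `j i`
    (j : S → R) (hj : ∀ i, C (Sum.inr i) = C (Sum.inl (j i)))
    -- step-size parameter; random initial estimates; values where an estimate is undefined
    (a : ℝ) (ha : 0 < a) (c0 : Ω → R ⊕ S → Label) (ws0 wd0 : Ω → ℝ) (alts altd : Ω → ℕ → ℝ) :
    -- the observed trajectory of the regular agents and the outputs of the algorithm
    let X : Ω → ℕ → R → ℝ := fun ω t r => state q x0 (fun u => e u ω) t (Sum.inl r)
    let xs : S → ℝ := fun s => x0 (Sum.inr s)
    let C' : Ω → ℕ → R ⊕ S → Label := fun ω => labelHat j (c0 ω) (X ω)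
    let ws' : Ω → ℕ → ℝ := fun ω => wsHat j xs a (ws0 ω) (alts ω) (X ω)
    let wd' : Ω → ℕ → ℝ := fun ω => wdHat j (wd0 ω) (altd ω) (X ω) (ws' ω)
    (∃ σ : Equiv.Perm Label,
      (σ = 1 ↔ 0 < (ws - wd) * (stubbornAvg C xs .one - stubbornAvg C xs .two)) ∧
      ∃ T : Ω → ℕ, Measurable T ∧ (∀ ω, 0 < T ω) ∧
        ∀ᵐ ω ∂μ, ∀ t, T ω < t → ∀ i, C' ω t i = σ (C i)) ∧
    ∀ᵐ ω ∂μ, Tendsto (fun t => (ws' ω t, wd' ω t)) atTop (𝓝 (ws, wd)) := by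
  intro X xs C' ws' wd'
  obtain ⟨r₀, -⟩ := hcomm.exists_regular .one
  have : Nonempty R := ⟨r₀⟩
  -- The product is nonzero by assumption; `σ` is the swap exactly when it is negative, and the
  -- labelling `σ ∘ C` always makes it positive.
  obtain ⟨σ, hσ, hpos, hcomm', hstub'⟩ : ∃ σ : Equiv.Perm Label,
      (σ = 1 ↔ 0 < (ws - wd) * (stubbornAvg C xs .one - stubbornAvg C xs .two)) ∧
      0 < (ws - wd) * (stubbornAvg (σ ∘ C) xs .one - stubbornAvg (σ ∘ C) xs .two) ∧
      CommunityAssumption (σ ∘ C) ws wd x0 ∧ StubbornAssumption (σ ∘ C) xs := by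
    rcases (mul_ne_zero (sub_ne_zero.2 hcomm.ws_ne_wd)
      (sub_ne_zero.2 hstub.avg_ne)).lt_or_gt with h | h
    · refine ⟨Equiv.swap .one .two, iff_of_false ?_ h.not_gt, ?_, hcomm.swap, hstub.swap⟩
      · rw [Equiv.Perm.one_def, Equiv.swap_eq_refl_iff]
        decide
      · rw [stubbornAvg_swap_comp, stubbornAvg_swap_comp, Equiv.swap_apply_left,
          Equiv.swap_apply_right]
        linarith
    · exact ⟨1, iff_of_true rfl h, h, hcomm, hstub⟩
  have he' : IsEdgeSelection μ (interactionMatrix (σ ∘ C) ws wd) e := by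
    rwa [interactionMatrix_comp]
  have hmain := ae_recover_eq_and_tendsto_estimates hq hcomm' hstub' he'
    (fun i => congrArg σ (hj i)) ha hpos ws0 wd0 alts altd
  refine ⟨⟨σ, hσ, ?_⟩, hmain.mono fun ω hω => hω.2⟩
  obtain ⟨T, hTm, hT0, hT⟩ := exists_measurable_time
    (fun t => he.measurableSet_recover_eq q x0 j (σ ∘ C) t) (hmain.mono fun ω hω => hω.1)
  refine ⟨T, hTm, hT0, hT.mono fun ω hω t ht i => ?_⟩
  -- At time zero `labelHat` is arbitrary; at successors it is the recovery step.
  obtain ⟨t, rfl⟩ := Nat.exists_eq_succ_of_ne_zero (by omega : t ≠ 0)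
  exact congrFun (hω _ ht) i
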